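/- Let $\mathbb K\in\{\mathbb R,\mathbb C\}$ and let $\ell_1=\ell_1(\mathbb N)$ be the Banach space of absolutely summable sequences over $\mathbb K$; an operator on $\ell_1$ is a continuous $\mathbb K$-linear map $T:\ell_1\to\ell_1$. Such a $T$ is weakly mixing if $T\oplus T$ is hypercyclic on $\ell_1\oplus\ell_1$, that is, if there is $(x,y)\in\ell_1\oplus\ell_1$ whose orbit $\{(T^nx,T^ny):n\ge 0\}$ is dense. A family $(T_i)_{i\in I}$ of operators on $\ell_1$ is disjoint hypercyclic if there is a vector $x\in\ell_1$ such that for every family $(U_i)_{i\in I}$ of nonempty open subsets of $\ell_1$ there is $n\ge 0$ with $T_i^n x\in U_i$ for all $i\in I$. A set $A$ of non-negative integers is Sidon if all the sums $a+b$ with $a,b\in A$, $a\le b$, are different. Theorem. Let $S\subseteq\{1,2,3,\dots\}$ be an arbitrary set of positive integers. Then $S\cup\{0\}$ is Sidon if and only if there is an operator $T:\ell_1\to\ell_1$ that is not weakly mixing and such that, for every finite subset $J\subseteq S$, the family $(T^j)_{j\in J}$ is disjoint hypercyclic. -/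

import Mathlib

/-- A set `A` of natural numbers is Sidon if all the sums `a + b` with `a, b ∈ A`, `a ≤ b`,
are different. -/
def IsSidonSet (A : Set ℕ) : Prop :=
  ∀ a ∈ A, ∀ b ∈ A, ∀ c ∈ A, ∀ d ∈ A, a ≤ b → c ≤ d → a + b = c + d → a = c ∧ b = d

section Operators

variable {𝕜 X ι : Type*} [Semiring 𝕜] [TopologicalSpace X] [AddCommMonoid X] [Module 𝕜 X]

/-- A continuous linear operator is hypercyclic if some vector has a dense orbit. -/
def IsHypercyclic (T : X →L[𝕜] X) : Prop :=
  ∃ x : X, Dense (Set.range fun n : ℕ => (T ^ n) x)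

/-- `T` is weakly mixing if `T ⊕ T` is hypercyclic on `X ⊕ X` (with the product topology). -/
def IsWeaklyMixing (T : X →L[𝕜] X) : Prop :=
  IsHypercyclic (T.prodMap T)

/-- A family `(T i)` of operators is disjoint hypercyclic if there is one vector `x` such that,
for every family `(U i)` of nonempty open sets, some `n` satisfies `(T i)^n x ∈ U i` for all `i`
simultaneously. -/
def IsDisjointHypercyclic (T : ι → X →L[𝕜] X) : Prop :=
  ∃ x : X, ∀ U : ι → Set X, (∀ i, IsOpen (U i)) → (∀ i, (U i).Nonempty) →
    ∃ n : ℕ, ∀ i, (T i ^ n) x ∈ U i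

end Operators

/-! Suppose `a + b = c + d` with `a < c ≤ d < b`. Disjoint hypercyclicity gives `y` and `n` with
`T^(an) y ∈ U`, with `T^(cn) y` and `T^(dn) y` in `W`, and with `T^(bn) y ∈ V`. Since `c - a = b -
d`, a single iterate of `T` takes a point of `U` into `W` and a point of `W` into `V`. For a
hypercyclic operator this forces weak mixing (`isWeaklyMixing_of_threeOpenSets`).

Conversely, let `T` be multiplication by `X` on `𝕜[X]`, completed for the `ℓ¹`-norm of a basis `q i`
of degree `i`. If `q (j * n) = A (X^(jn) - P j)`, then `T^(jn) 1` lies at distance `1 / A` from `P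
j`. Arranging this for all finite `J ⊆ S`, a dense family of targets and all `A` makes `1` a common
disjoint hypercyclic vector. The form `(p, p') ↦ φ (p * p')` satisfies `B (T x) y = B x (T y)`, so
its being bounded and nonzero excludes weak mixing.

The two demands interact: `X^(jn) ≈ P j` suggests `φ (X^((j+j')n) * p) = φ (P j * P j' * p)`. This
prescription is consistent because, by the Sidon property of `S ∪ {0}`, the sum `j + j'` determines
the pair. `IsBlockExtension` realises one such prescription in high degrees, and infinitely many
extensions are glued in `exists_isBoundedBasis_approximating`. -/

/-! ### Criteria for and against weak mixing. -/

section Dynamics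

open Filter Topology

variable {𝕜 X : Type*} [NontriviallyNormedField 𝕜] [NormedAddCommGroup X] [NormedSpace 𝕜 X]

/-- Birkhoff's transitivity theorem. -/
theorem isHypercyclic_of_transitive [CompleteSpace X] [SecondCountableTopology X]
    (T : X →L[𝕜] X)
    (h : ∀ U V : Set X, IsOpen U → IsOpen V → U.Nonempty → V.Nonempty →
      ∃ n : ℕ, ∃ u ∈ U, (T ^ n) u ∈ V) : IsHypercyclic T := by
  have hd : Dense (⋂ V ∈ TopologicalSpace.countableBasis X, ⋃ n : ℕ, (T ^ n) ⁻¹' V) := by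
    refine dense_biInter_of_isOpen ?_ (TopologicalSpace.countable_countableBasis X) ?_
    · exact fun V hV => isOpen_iUnion fun n =>
        (TopologicalSpace.isOpen_of_mem_countableBasis hV).preimage (T ^ n).continuous
    · intro V hV
      rw [dense_iff_inter_open]
      intro U hU hUn
      obtain ⟨n, u, hu, hv⟩ := h U V hU (TopologicalSpace.isOpen_of_mem_countableBasis hV) hUn
        (TopologicalSpace.nonempty_of_mem_countableBasis hV)
      exact ⟨u, hu, Set.mem_iUnion.2 ⟨n, hv⟩⟩
  obtain ⟨x, hx⟩ := hd.nonempty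
  refine ⟨x, ?_⟩
  rw [(TopologicalSpace.isBasis_countableBasis X).dense_iff]
  intro V hV _
  obtain ⟨n, hn⟩ := Set.mem_iUnion.1 (Set.mem_iInter₂.1 hx V hV)
  exact ⟨_, hn, n, rfl⟩

/-- A nontrivial normed space has no isolated points, so the orbit stays dense without `x`, and what
remains lies in the range of `T`. -/
theorem denseRange_pow_of_dense_orbit [Nontrivial X] {T : X →L[𝕜] X} {x : X}
    (hx : Dense (Set.range fun n : ℕ => (T ^ n) x)) (m : ℕ) : DenseRange (T ^ m) := by
  have hT : DenseRange T := by
    have : ∀ y : X, (𝓝[≠] y).NeBot := fun y => Module.punctured_nhds_neBot 𝕜 X y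
    refine (hx.sdiff_singleton x).mono ?_
    rintro _ ⟨⟨n, rfl⟩, hn⟩
    rcases n with _ | n
    · simp at hn
    · exact ⟨(T ^ n) x, by simp [pow_succ']⟩
  induction m with
  | zero => exact fun y => subset_closure ⟨y, by simp⟩
  | succ m ih =>
    have := ih.comp hT (T ^ m).continuous
    simpa [pow_succ, Function.comp_def] using this

theorem dense_orbit_pow [Nontrivial X] {T : X →L[𝕜] X} {x : X}
    (hx : Dense (Set.range fun n : ℕ => (T ^ n) x)) (m : ℕ) :
    Dense (Set.range fun n : ℕ => (T ^ n) ((T ^ m) x)) := by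
  have := (denseRange_pow_of_dense_orbit hx m).comp (f := fun n : ℕ => (T ^ n) x) hx
    (T ^ m).continuous
  refine this.mono ?_
  rintro _ ⟨n, rfl⟩
  exact ⟨n, by simp only [Function.comp, ← mul_apply_eq_comp, ← pow_add, add_comm]⟩

theorem prodMap_pow_apply (T : X →L[𝕜] X) (n : ℕ) (p : X × X) :
    ((T.prodMap T) ^ n) p = ((T ^ n) p.1, (T ^ n) p.2) := by
  induction n with
  | zero => simp
  | succ n ih => simp [pow_succ', ih]

/-- Pairs `(u, T^m u)` are dense in `X × X`, so transitivity of `T ⊕ T` only has to be checked near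
such pairs. The condition is applied with `W` a neighbourhood of `0`. -/
theorem isWeaklyMixing_of_threeOpenSets [CompleteSpace X] [Nontrivial X] {T : X →L[𝕜] X}
    (hT : IsHypercyclic T)
    (h : ∀ U W V : Set X, IsOpen U → IsOpen W → IsOpen V → U.Nonempty → W.Nonempty → V.Nonempty →
      ∃ n : ℕ, (∃ u ∈ U, (T ^ n) u ∈ W) ∧ ∃ w ∈ W, (T ^ n) w ∈ V) : IsWeaklyMixing T := by
  obtain ⟨x, hx⟩ := hT
  have : TopologicalSpace.SeparableSpace X := ⟨_, Set.countable_range _, hx⟩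
  have : SecondCountableTopology X := UniformSpace.secondCountable_of_separable X
  have key : ∀ O : Set (X × X), IsOpen O → O.Nonempty → ∃ (u : X) (m : ℕ), (u, (T ^ m) u) ∈ O := by
    rintro O hO ⟨⟨y, z⟩, hyz⟩
    obtain ⟨A, B, hA, hB, hyA, hzB, hAB⟩ := isOpen_prod_iff.1 hO y z hyz
    obtain ⟨_, hp, p, rfl⟩ := hx.inter_open_nonempty A hA ⟨y, hyA⟩
    obtain ⟨_, hm, m, rfl⟩ := (dense_orbit_pow hx p).inter_open_nonempty B hB ⟨z, hzB⟩
    exact ⟨_, m, hAB ⟨hp, hm⟩⟩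
  refine isHypercyclic_of_transitive _ fun O O' hO hO' hOn hOn' => ?_
  obtain ⟨u, m, hu⟩ := key O hO hOn
  obtain ⟨v, k, hv⟩ := key O' hO' hOn'
  -- `F` intertwines `T ⊕ T` with itself, and `F (u, 0) ∈ O`, `F (0, v) ∈ O'`. It thus suffices to
  -- move `(u', w)` near `(u, 0)` to a point near `(0, v)`.
  let F : X × X → X × X := fun p => (p.1 + p.2, (T ^ m) p.1 + (T ^ k) p.2)
  have hF : Continuous F := by fun_prop
  obtain ⟨U, W₂, hU, hW₂, huU, h0W₂, hUW⟩ := isOpen_prod_iff.1 (hO.preimage hF) u 0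
    (by simpa [F] using hu)
  obtain ⟨W₁, V, hW₁, hV, h0W₁, hvV, hWV⟩ := isOpen_prod_iff.1 (hO'.preimage hF) 0 v
    (by simpa [F] using hv)
  obtain ⟨n, ⟨u', hu', hu''⟩, w, hw, hw'⟩ := h U (W₁ ∩ W₂) V hU (hW₁.inter hW₂) hV ⟨u, huU⟩
    ⟨0, h0W₁, h0W₂⟩ ⟨v, hvV⟩
  refine ⟨n, F (u', w), hUW ⟨hu', hw.2⟩, ?_⟩
  have := hWV (Set.mk_mem_prod hu''.1 hw')
  rw [prodMap_pow_apply]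
  have hF' : ((T ^ n) (F (u', w)).1, (T ^ n) (F (u', w)).2) = F ((T ^ n) u', (T ^ n) w) := by
    simp only [F, map_add, ← mul_apply_eq_comp, ← pow_add, add_comm n]
  rw [hF']
  exact this

theorem isWeaklyMixing_of_add_eq_add [CompleteSpace X] [Nontrivial X] {T : X →L[𝕜] X}
    {a b c d : ℕ} (hac : a < c) (hcd : c ≤ d) (h : a + b = c + d) {J : Finset ℕ}
    (ha : a = 0 ∨ a ∈ J) (hb : b ∈ J) (hc : c ∈ J) (hd : d ∈ J)
    (hT : IsDisjointHypercyclic (fun j : J => T ^ (j : ℕ))) : IsWeaklyMixing T := by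
  obtain ⟨x, hx⟩ := hT
  have hxd : Dense (Set.range fun n : ℕ => (T ^ n) x) := by
    rw [dense_iff_inter_open]
    intro O hO hOn
    obtain ⟨n, hn⟩ := hx (fun _ => O) (fun _ => hO) fun _ => hOn
    exact ⟨_, hn ⟨b, hb⟩, b * n, by simp [pow_mul]⟩
  refine isWeaklyMixing_of_threeOpenSets ⟨x, hxd⟩ fun U W V hU hW hV hUn hWn hVn => ?_
  -- Starting from `T^m x ∈ U` covers the case `a = 0`, where the power `T^0` is not in the family;
  -- the other targets are pulled back along `T^m`.
  obtain ⟨_, hm, m, rfl⟩ := hxd.inter_open_nonempty U hU hUn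
  let O : ℕ → Set X := fun j => if j = a then U else if j = b then V else W
  have hO : ∀ j, IsOpen (O j) := by intro j; simp only [O]; split_ifs <;> assumption
  have hOn : ∀ j, (O j).Nonempty := by intro j; simp only [O]; split_ifs <;> assumption
  obtain ⟨n, hn⟩ := hx (fun j => (T ^ m) ⁻¹' O j) (fun j => (hO j).preimage (T ^ m).continuous)
    fun j => by
      obtain ⟨y, hy⟩ := (denseRange_pow_of_dense_orbit hxd m).exists_mem_open (hO j) (hOn j)
      exact ⟨y, hy⟩
  have hn' : ∀ j ∈ J, (T ^ (j * n)) ((T ^ m) x) ∈ O j := by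
    intro j hj
    have := hn ⟨j, hj⟩
    simp only [Set.mem_preimage, ← pow_mul, ← mul_apply_eq_comp, ← pow_add] at this ⊢
    rwa [add_comm]
  have h1 : (T ^ (a * n)) ((T ^ m) x) ∈ U := by
    rcases ha with ha | ha
    · simpa [ha] using hm
    · simpa [O] using hn' a ha
  have h2 : (T ^ (c * n)) ((T ^ m) x) ∈ W := by
    simpa [O, show c ≠ a by omega, show c ≠ b by omega] using hn' c hc
  have h3 : (T ^ (d * n)) ((T ^ m) x) ∈ W := by
    simpa [O, show d ≠ a by omega, show d ≠ b by omega] using hn' d hd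
  have h4 : (T ^ (b * n)) ((T ^ m) x) ∈ V := by
    simpa [O, show b ≠ a by omega] using hn' b hb
  refine ⟨(c - a) * n, ⟨_, h1, ?_⟩, _, h3, ?_⟩
  · rw [← mul_apply_eq_comp, ← pow_add, ← add_mul, Nat.sub_add_cancel hac.le]
    exact h2
  · rw [← mul_apply_eq_comp, ← pow_add, ← add_mul, show c - a + d = b by omega]
    exact h4

theorem isSidonSet_of_disjointHypercyclic [CompleteSpace X] [Nontrivial X] {T : X →L[𝕜] X}
    (hT : ¬ IsWeaklyMixing T) {S : Set ℕ}
    (h : ∀ J : Finset ℕ, (J : Set ℕ) ⊆ S → IsDisjointHypercyclic (fun j : J => T ^ (j : ℕ))) :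
    IsSidonSet (S ∪ {0}) := by
  have key : ∀ a ∈ S ∪ {0}, ∀ b ∈ S ∪ {0}, ∀ c ∈ S ∪ {0}, ∀ d ∈ S ∪ {0}, c ≤ d →
      a + b = c + d → ¬ a < c := by
    intro a ha b hb c hc d hd hcd hs hac
    have mem : ∀ j ∈ S ∪ {0}, j ≠ 0 → j ∈ S := by
      rintro j (hj | hj) h0
      · exact hj
      · exact absurd hj h0
    refine hT (isWeaklyMixing_of_add_eq_add hac hcd hs (J := ({a, b, c, d} : Finset ℕ).erase 0)
      ?_ ?_ ?_ ?_ (h _ ?_))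
    · by_cases h0 : a = 0 <;> simp [h0]
    · simp; omega
    · simp; omega
    · simp; omega
    · intro j hj
      simp only [Finset.coe_erase, Set.mem_sdiff, Finset.mem_coe, Finset.mem_insert,
        Finset.mem_singleton, Set.mem_singleton_iff] at hj
      rcases hj with ⟨rfl | rfl | rfl | rfl, h0⟩ <;> exact mem _ (by assumption) h0
  intro a ha b hb c hc d hd hab hcd hs
  have h1 := key a ha b hb c hc d hd hcd hs
  have h2 := key c hc d hd a ha b hb hab hs.symm
  omega

/-- A nonzero bounded bilinear form for which `T` is self-adjoint prevents weak mixing. -/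
theorem not_isWeaklyMixing_of_bilin {T : X →L[𝕜] X}
    (B : X →L[𝕜] X →L[𝕜] 𝕜) (hB : B ≠ 0) (h : ∀ x y, B (T x) y = B x (T y)) :
    ¬ IsWeaklyMixing T := by
  rintro ⟨⟨u, v⟩, huv⟩
  have hpow : ∀ (n : ℕ) x y, B ((T ^ n) x) y = B x ((T ^ n) y) := by
    intro n
    induction n with
    | zero => simp
    | succ n ih => intro x y; rw [pow_succ', mul_apply_eq_comp, h, ih, ← mul_apply_eq_comp,
        ← pow_succ, ← pow_succ']
  have h1 : ∀ p : X × X, B p.1 v = B u p.2 := by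
    refine fun p => huv.induction (P := fun p : X × X => B p.1 v = B u p.2) ?_ ?_ p
    · rintro _ ⟨n, rfl⟩
      simp only [prodMap_pow_apply]
      exact hpow n u v
    · exact isClosed_eq (by fun_prop) (by fun_prop)
  have h2 : ∀ y, B u y = 0 := fun y => by simpa using (h1 (0, y)).symm
  have hu : Dense (Set.range fun n : ℕ => (T ^ n) u) := by
    have := Prod.fst_surjective.denseRange.dense_image continuous_fst huv
    refine this.mono ?_
    rintro _ ⟨_, ⟨n, rfl⟩, rfl⟩
    exact ⟨n, by simp⟩
  refine hB (ContinuousLinearMap.ext fun x => ?_)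
  refine hu.induction (P := fun x => B x = 0) ?_ (isClosed_eq (by fun_prop) (by fun_prop)) x
  rintro _ ⟨n, rfl⟩
  ext y
  simp only [hpow, h2, zero_apply]

end Dynamics

/-! ### Polynomial bases and functionals with uniform bounds. -/

section PolynomialBases

open Polynomial Finset

variable {𝕜 : Type*} [RCLike 𝕜]

/-- `p` is a combination of the `q l`, `l < m`, with coefficients of total modulus at most `R`. -/
def ExpandsWithin (q : ℕ → 𝕜[X]) (m : ℕ) (R : ℝ) (p : 𝕜[X]) : Prop :=
  ∃ a : ℕ → 𝕜, p = ∑ l ∈ range m, C (a l) * q l ∧ ∑ l ∈ range m, ‖a l‖ ≤ R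

namespace ExpandsWithin

variable {q q' : ℕ → 𝕜[X]} {m m' : ℕ} {R R' : ℝ} {p p' : 𝕜[X]}

theorem mono (h : ExpandsWithin q m R p) (hm : m ≤ m') (hR : R ≤ R') :
    ExpandsWithin q m' R' p := by
  obtain ⟨a, rfl, ha⟩ := h
  refine ⟨fun l => if l < m then a l else 0, ?_, ?_⟩
  · rw [← sum_subset (range_mono hm) (fun l _ hl => by simp [mem_range.not.1 hl])]
    exact sum_congr rfl fun l hl => by simp [mem_range.1 hl]
  · rw [← sum_subset (range_mono hm) (fun l _ hl => by simp [mem_range.not.1 hl])]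
    refine le_trans (le_of_eq (sum_congr rfl fun l hl => by simp [mem_range.1 hl])) (ha.trans hR)

theorem congr (h : ExpandsWithin q m R p) (hq : ∀ l < m, q' l = q l) : ExpandsWithin q' m R p := by
  obtain ⟨a, rfl, ha⟩ := h
  exact ⟨a, sum_congr rfl fun l hl => by rw [hq l (mem_range.1 hl)], ha⟩

theorem zero : ExpandsWithin q m 0 0 := ⟨0, by simp, by simp⟩

theorem add (h : ExpandsWithin q m R p) (h' : ExpandsWithin q m R' p') :
    ExpandsWithin q m (R + R') (p + p') := by
  obtain ⟨a, rfl, ha⟩ := h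
  obtain ⟨b, rfl, hb⟩ := h'
  refine ⟨a + b, by simp [add_mul, sum_add_distrib], ?_⟩
  calc _ ≤ ∑ l ∈ range m, (‖a l‖ + ‖b l‖) := sum_le_sum fun l _ => norm_add_le _ _
    _ ≤ R + R' := by rw [sum_add_distrib]; exact add_le_add ha hb

theorem C_mul (h : ExpandsWithin q m R p) (c : 𝕜) : ExpandsWithin q m (‖c‖ * R) (C c * p) := by
  obtain ⟨a, rfl, ha⟩ := h
  refine ⟨fun l => c * a l, by simp [mul_sum, mul_assoc], ?_⟩
  simp only [norm_mul, ← mul_sum]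
  gcongr

theorem sub (h : ExpandsWithin q m R p) (h' : ExpandsWithin q m R' p') :
    ExpandsWithin q m (R + R') (p - p') := by
  have := h.add (h'.C_mul (-1))
  simpa [sub_eq_add_neg] using this

theorem sum {ι : Type*} {s : Finset ι} {f : ι → 𝕜[X]} {S : ι → ℝ}
    (h : ∀ i ∈ s, ExpandsWithin q m (S i) (f i)) :
    ExpandsWithin q m (∑ i ∈ s, S i) (∑ i ∈ s, f i) := by
  classical
  induction s using Finset.induction_on with
  | empty => simpa using zero
  | insert i s hi ih =>
    rw [sum_insert hi, sum_insert hi]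
    exact (h i (mem_insert_self i s)).add (ih fun k hk => h k (mem_insert_of_mem hk))

theorem self {l : ℕ} (hl : l < m) : ExpandsWithin q m 1 (q l) := by
  refine ⟨fun k => if k = l then 1 else 0, ?_, ?_⟩
  · rw [sum_eq_single l (fun k _ hk => by simp [hk]) (fun h => absurd (mem_range.2 hl) h)]
    simp
  · rw [sum_eq_single l (fun k _ hk => by simp [hk]) (fun h => absurd (mem_range.2 hl) h)]
    simp

theorem X_pow {i : ℕ} (hi : i < m) (hq : q i = C (((i : 𝕜) + 1)⁻¹) * X ^ i) :
    ExpandsWithin q m (i + 1) (X ^ i) := by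
  have h0 : ((i : 𝕜) + 1) ≠ 0 := by exact_mod_cast Nat.succ_ne_zero i
  have h := (self (q := q) hi).C_mul ((i : 𝕜) + 1)
  rw [hq, ← mul_assoc, ← map_mul, mul_inv_cancel₀ h0, map_one, one_mul, mul_one] at h
  refine h.mono le_rfl (le_of_eq ?_)
  have : ((i : 𝕜) + 1) = ((i + 1 : ℕ) : 𝕜) := by push_cast; rfl
  rw [this, RCLike.norm_natCast]
  push_cast
  rfl

theorem X_pow_mul {d t : ℕ} (hp : p.natDegree < d)
    (h : ∀ i < d, ExpandsWithin q m R (X ^ (t + i))) :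
    ExpandsWithin q m ((∑ i ∈ range d, ‖p.coeff i‖) * R) (X ^ t * p) := by
  have e : X ^ t * p = ∑ i ∈ range d, C (p.coeff i) * X ^ (t + i) := by
    conv_lhs => rw [p.as_sum_range_C_mul_X_pow' hp]
    rw [mul_sum]
    exact sum_congr rfl fun i _ => by rw [pow_add]; ring
  rw [e, sum_mul]
  exact sum fun i hi => (h i (mem_range.1 hi)).C_mul _

end ExpandsWithin

theorem exists_expandsWithin {q : ℕ → 𝕜[X]} (hq : ∀ i, (q i).degree = i) (m : ℕ) :
    ∀ p : 𝕜[X], p.degree < m → ∃ R, ExpandsWithin q m R p := by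
  induction m with
  | zero =>
    intro p hp
    have : p = 0 := by
      rw [← degree_eq_bot]
      exact Nat.WithBot.lt_zero_iff.1 (by simpa using hp)
    exact ⟨0, this ▸ ExpandsWithin.zero⟩
  | succ m ih =>
    intro p hp
    have hqm : (q m).coeff m ≠ 0 := coeff_ne_zero_of_eq_degree (hq m)
    obtain ⟨R, hR⟩ := ih (p - C (p.coeff m / (q m).coeff m) * q m) (by
      rw [degree_lt_iff_coeff_zero]
      intro k hk
      rcases hk.eq_or_lt with rfl | hk
      · simp [hqm]
      · rw [coeff_sub, coeff_C_mul, coeff_eq_zero_of_degree_lt (n := k) (p := q m),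
          coeff_eq_zero_of_degree_lt (n := k) (p := p)]
        · simp
        · exact hp.trans_le (by exact_mod_cast hk)
        · rw [hq]; exact_mod_cast hk)
    have := (hR.mono m.le_succ le_rfl).add
      ((ExpandsWithin.self (q := q) m.lt_succ_self).C_mul (p.coeff m / (q m).coeff m))
    rw [sub_add_cancel] at this
    exact ⟨_, this⟩

theorem exists_linearMap_X_pow (g : ℕ → 𝕜) : ∃ ψ : 𝕜[X] →ₗ[𝕜] 𝕜, ∀ m, ψ (X ^ m) = g m :=
  ⟨(basisMonomials 𝕜).constr 𝕜 g, fun m => by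
    simpa [monomial_one_right_eq_X_pow] using (basisMonomials 𝕜).constr_basis 𝕜 g m⟩

theorem linearMap_eq_of_natDegree_lt {ψ χ : 𝕜[X] →ₗ[𝕜] 𝕜} {n : ℕ}
    (h : ∀ m < n, ψ (X ^ m) = χ (X ^ m)) {p : 𝕜[X]} (hp : p.natDegree < n) : ψ p = χ p := by
  rw [p.as_sum_range_C_mul_X_pow' hp, map_sum, map_sum]
  refine sum_congr rfl fun i hi => ?_
  rw [← smul_eq_C_mul, map_smul, map_smul, h i (mem_range.1 hi)]

/-- The constant depends on `p` alone, not on the functional or the shift `t`, so it can be fixed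
before the block length. -/
theorem exists_functional_bound (p : 𝕜[X]) : ∃ K : ℕ, ∀ (ψ : 𝕜[X] →ₗ[𝕜] 𝕜) (Φ : ℝ),
    (∀ m, ‖ψ (X ^ m)‖ ≤ Φ) → ∀ t, ‖ψ (X ^ t * p)‖ ≤ K * Φ := by
  induction p using Polynomial.induction_on' with
  | add p p' ih ih' =>
    obtain ⟨K, hK⟩ := ih
    obtain ⟨K', hK'⟩ := ih'
    refine ⟨K + K', fun ψ Φ h t => ?_⟩
    rw [mul_add, map_add]
    push_cast
    rw [add_mul]
    exact (norm_add_le _ _).trans (add_le_add (hK ψ Φ h t) (hK' ψ Φ h t))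
  | monomial k a =>
    obtain ⟨K, hK⟩ := exists_nat_ge ‖a‖
    refine ⟨K, fun ψ Φ h t => ?_⟩
    rw [← C_mul_X_pow_eq_monomial, mul_left_comm, ← pow_add, ← smul_eq_C_mul, map_smul, norm_smul]
    exact mul_le_mul hK (h _) (norm_nonneg _) (Nat.cast_nonneg K)

theorem exists_nat_bound {Q : ℕ → ℕ → Prop} (hQ : ∀ i K K', K ≤ K' → Q i K → Q i K')
    (s : Finset ℕ) (h : ∀ i ∈ s, ∃ K, Q i K) : ∃ K, ∀ i ∈ s, Q i K := by
  choose! K hK using h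
  exact ⟨∑ i ∈ s, K i, fun i hi =>
    hQ i _ _ (single_le_sum (f := K) (fun _ _ => Nat.zero_le _) hi) (hK i hi)⟩

/-- Every finite family of polynomials admits a uniform functional bound. -/
theorem exists_uniform_functional_bound (f : ℕ → 𝕜[X]) (s : Finset ℕ) :
    ∃ K : ℕ, ∀ i ∈ s, ∀ (ψ : 𝕜[X] →ₗ[𝕜] 𝕜) (Φ : ℝ),
      (∀ m, ‖ψ (X ^ m)‖ ≤ Φ) → ∀ t, ‖ψ (X ^ t * f i)‖ ≤ K * Φ := by
  refine exists_nat_bound (Q := fun i K => ∀ (ψ : 𝕜[X] →ₗ[𝕜] 𝕜) (Φ : ℝ),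
      (∀ m, ‖ψ (X ^ m)‖ ≤ Φ) → ∀ t, ‖ψ (X ^ t * f i)‖ ≤ K * Φ) ?_ s
      fun i _ => exists_functional_bound (f i)
  intro i K K' hKK h ψ Φ hΦ t
  have : 0 ≤ Φ := (norm_nonneg _).trans (hΦ 0)
  exact (h ψ Φ hΦ t).trans (by gcongr)

/-- A basis of the polynomials in which multiplication by `X` is bounded for the `ℓ¹`-norm,
together with a functional that is bounded on products of basis elements. -/
structure IsBoundedBasis (q : ℕ → 𝕜[X]) (φ : 𝕜[X] →ₗ[𝕜] 𝕜) : Prop where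
  q_zero : q 0 = 1
  degree_q : ∀ i, (q i).degree = i
  expands : ∀ i, ExpandsWithin q (i + 2) 2 (X * q i)
  norm_le : ∀ i j, ‖φ (q i * q j)‖ ≤ 1
  map_one : φ 1 = 1

/-- Beyond `N`, the basis consists of multiples of monomials and the functional vanishes. -/
structure IsTrivialFrom (N : ℕ) (q : ℕ → 𝕜[X]) (φ : 𝕜[X] →ₗ[𝕜] 𝕜) : Prop where
  q_tail : ∀ i, N ≤ i → q i = C (((i : 𝕜) + 1)⁻¹) * X ^ i
  φ_tail : ∀ m, N ≤ m → φ (X ^ m) = 0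

theorem norm_inv_natCast_succ (i : ℕ) : ‖((i : 𝕜) + 1)⁻¹‖ = ((i : ℝ) + 1)⁻¹ := by
  have : ((i : 𝕜) + 1) = ((i + 1 : ℕ) : 𝕜) := by push_cast; rfl
  rw [norm_inv, this, RCLike.norm_natCast]
  push_cast
  rfl

theorem expandsWithin_X_mul {q : ℕ → 𝕜[X]} {i : ℕ} (hi : q i = C (((i : 𝕜) + 1)⁻¹) * X ^ i)
    (hi' : q (i + 1) = C ((((i + 1 : ℕ) : 𝕜) + 1)⁻¹) * X ^ (i + 1)) :
    ExpandsWithin q (i + 2) 2 (X * q i) := by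
  have h := (ExpandsWithin.X_pow (m := i + 2) (by omega) hi').C_mul (((i : 𝕜) + 1)⁻¹)
  have e : X * q i = C (((i : 𝕜) + 1)⁻¹) * X ^ (i + 1) := by rw [hi]; ring
  rw [e]
  refine h.mono le_rfl ?_
  rw [norm_inv_natCast_succ, inv_mul_le_iff₀ (by positivity)]
  push_cast
  nlinarith [(Nat.cast_nonneg i : (0 : ℝ) ≤ i)]

/-- The starting point: scaled monomials, with `φ` the evaluation at `0`. -/
theorem exists_isBoundedBasis : ∃ (q : ℕ → 𝕜[X]) (φ : 𝕜[X] →ₗ[𝕜] 𝕜),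
    IsBoundedBasis q φ ∧ IsTrivialFrom 1 q φ := by
  obtain ⟨φ, hφ⟩ := exists_linearMap_X_pow (fun m => if m = 0 then (1 : 𝕜) else 0)
  have hne : ∀ i : ℕ, ((i : 𝕜) + 1)⁻¹ ≠ 0 := fun i =>
    inv_ne_zero (by exact_mod_cast Nat.succ_ne_zero i)
  refine ⟨fun i => C (((i : 𝕜) + 1)⁻¹) * X ^ i, φ, ⟨by simp, fun i => ?_, fun i => ?_,
    fun i j => ?_, ?_⟩, fun i _ => rfl, fun m hm => ?_⟩
  · exact degree_C_mul_X_pow i (hne i)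
  · exact expandsWithin_X_mul rfl rfl
  · have e : C (((i : 𝕜) + 1)⁻¹) * X ^ i * (C (((j : 𝕜) + 1)⁻¹) * X ^ j) =
        (((i : 𝕜) + 1)⁻¹ * ((j : 𝕜) + 1)⁻¹) • X ^ (i + j) := by
      rw [smul_eq_C_mul, map_mul]; ring
    rw [e, map_smul, norm_smul, norm_mul, norm_inv_natCast_succ, norm_inv_natCast_succ, hφ]
    have h1 : ∀ i : ℕ, ((i : ℝ) + 1)⁻¹ ≤ 1 := fun i => inv_le_one_of_one_le₀ (by simp)
    have h2 : ‖(if i + j = 0 then (1 : 𝕜) else 0)‖ ≤ 1 := by split_ifs <;> simp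
    exact mul_le_one₀ (mul_le_one₀ (h1 i) (by positivity) (h1 j)) (norm_nonneg _) h2
  · simpa using hφ 0
  · rw [hφ, if_neg (by omega)]

end PolynomialBases

/-! ### Extending the functional and bounding it on products. -/

section BlockExtensions

open Polynomial Finset

variable {𝕜 : Type*} [RCLike 𝕜]

/-- `q'` modifies `q` in the blocks `[4Lj, 4Lj + L)`, `j ∈ J`, where it consists of multiples of
`X ^ r * (X ^ (4Lj) - P j)`, and `φ'` is an extension of `φ` which is compatible with replacing
`X ^ (4L(j + j'))` by `P j * P j'`. -/
structure IsBlockExtension (q q' : ℕ → 𝕜[X]) (φ φ' : 𝕜[X] →ₗ[𝕜] 𝕜) (J : Finset ℕ)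
    (P : ℕ → 𝕜[X]) (A L : ℕ) : Prop where
  block : ∀ j ∈ J, ∀ r < L,
    q' (4 * L * j + r) = C ((A : 𝕜) / 2 ^ r) * (X ^ r * (X ^ (4 * L * j) - P j))
  gap : ∀ j r, r < 4 * L → ¬ (j ∈ J ∧ r < L) → q' (4 * L * j + r) = q (4 * L * j + r)
  φ_eq : ∀ j ∈ insert 0 J, ∀ j' ∈ insert 0 J, ∀ p : 𝕜[X], p.natDegree < 4 * L →
    φ' (X ^ (4 * L * (j + j')) * p) = φ (P j * P j' * p)

/-- Exponents are written in base `4 * L`: `φ'` reads `X^(4Ls + r)` as `φ (X^r * Q s)`, where `Q (j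
+ j') = P j * P j'` and `Q` vanishes off the sumset. The bound `G` precedes `L`, so `L` may later be
chosen large in terms of `G`. -/
theorem exists_blockExtension (q : ℕ → 𝕜[X]) (φ : 𝕜[X] →ₗ[𝕜] 𝕜) {J : Finset ℕ}
    (hJ : IsSidonSet ((insert 0 J : Finset ℕ) : Set ℕ)) (P : ℕ → 𝕜[X]) (A : ℕ) {N : ℕ}
    (hφ : ∀ m, N ≤ m → φ (X ^ m) = 0) :
    ∃ G : ℕ, ∀ L, N ≤ L → 0 < L → ∃ (q' : ℕ → 𝕜[X]) (φ' : 𝕜[X] →ₗ[𝕜] 𝕜) (N' : ℕ),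
      IsBlockExtension q q' φ φ' J P A L ∧ (∀ m, ‖φ' (X ^ m)‖ ≤ G) ∧
      4 * L < N' ∧ (∀ j ∈ J, 4 * L * j + L ≤ N') ∧ ∀ m, N' ≤ m → φ' (X ^ m) = 0 := by
  classical
  let J0 := insert 0 J
  obtain ⟨Q, hQ, hQ0⟩ : ∃ Q : ℕ → 𝕜[X], (∀ j ∈ J0, ∀ j' ∈ J0, Q (j + j') = P j * P j') ∧
      ∀ s, s ∉ (J0 ×ˢ J0).image (fun x => x.1 + x.2) → Q s = 0 := by
    -- The pair representing `s` is chosen arbitrarily; the Sidon property makes it unique up to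
    -- order, so the product does not depend on the choice.
    refine ⟨fun s => if h : ∃ x : ℕ × ℕ, (x.1 ∈ J0 ∧ x.2 ∈ J0) ∧ x.1 + x.2 = s then
      P h.choose.1 * P h.choose.2 else 0, ?_, ?_⟩
    · intro j hj j' hj'
      have h : ∃ x : ℕ × ℕ, (x.1 ∈ J0 ∧ x.2 ∈ J0) ∧ x.1 + x.2 = j + j' := ⟨(j, j'), ⟨hj, hj'⟩, rfl⟩
      simp only [dif_pos h]
      obtain ⟨⟨h1, h2⟩, h3⟩ := h.choose_spec
      generalize h.choose.1 = k at h1 h3 ⊢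
      generalize h.choose.2 = k' at h2 h3 ⊢
      rcases le_total k k' with hk | hk <;> rcases le_total j j' with hjj | hjj
      · obtain ⟨rfl, rfl⟩ := hJ k h1 k' h2 j hj j' hj' hk hjj h3; rfl
      · obtain ⟨rfl, rfl⟩ := hJ k h1 k' h2 j' hj' j hj hk hjj (by omega); exact mul_comm _ _
      · obtain ⟨rfl, rfl⟩ := hJ k' h2 k h1 j hj j' hj' hk hjj (by omega); exact mul_comm _ _
      · obtain ⟨rfl, rfl⟩ := hJ k' h2 k h1 j' hj' j hj hk hjj (by omega); rfl
    · intro s hs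
      refine dif_neg ?_
      rintro ⟨x, hx, rfl⟩
      exact hs (mem_image.2 ⟨x, mem_product.2 hx, rfl⟩)
  set D := (J0 ×ˢ J0).image (fun x => x.1 + x.2)
  obtain ⟨Φ, hΦ⟩ := exists_nat_bound (Q := fun m K => ‖φ (X ^ m)‖ ≤ K)
    (fun i K K' hK h => h.trans (by exact_mod_cast hK)) (range N) fun i _ => exists_nat_ge _
  have hΦ' : ∀ m, ‖φ (X ^ m)‖ ≤ (Φ : ℝ) := by
    intro m
    rcases lt_or_ge m N with hm | hm
    · exact hΦ m (mem_range.2 hm)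
    · simp [hφ m hm]
  obtain ⟨K, hK⟩ := exists_uniform_functional_bound Q D
  refine ⟨K * Φ, fun L hN hL => ?_⟩
  obtain ⟨φ', hφ'⟩ := exists_linearMap_X_pow
    (fun m => φ (X ^ (m % (4 * L)) * Q (m / (4 * L))))
  refine ⟨fun i => if i / (4 * L) ∈ J ∧ i % (4 * L) < L then
    C ((A : 𝕜) / 2 ^ (i % (4 * L))) * (X ^ (i % (4 * L)) * (X ^ (4 * L * (i / (4 * L))) -
      P (i / (4 * L)))) else q i, φ', 4 * L * (∑ s ∈ D, s + ∑ j ∈ J, j + 2), ⟨?_, ?_, ?_⟩, ?_, ?_,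
      ?_, ?_⟩
  · intro j hj r hr
    have h1 : (4 * L * j + r) / (4 * L) = j := by
      rw [Nat.mul_add_div (by omega), Nat.div_eq_of_lt (by omega), add_zero]
    have h2 : (4 * L * j + r) % (4 * L) = r := by
      rw [Nat.mul_add_mod, Nat.mod_eq_of_lt (by omega)]
    simp only [h1, h2, hj, hr, and_self, if_true]
  · intro j r hr h
    have h1 : (4 * L * j + r) / (4 * L) = j := by
      rw [Nat.mul_add_div (by omega), Nat.div_eq_of_lt (by omega), add_zero]
    have h2 : (4 * L * j + r) % (4 * L) = r := by
      rw [Nat.mul_add_mod, Nat.mod_eq_of_lt (by omega)]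
    simp only [h1, h2, h, if_false]
  · intro j hj j' hj' p hp
    have := linearMap_eq_of_natDegree_lt
      (ψ := φ'.comp (LinearMap.mulLeft 𝕜 (X ^ (4 * L * (j + j')))))
      (χ := φ.comp (LinearMap.mulLeft 𝕜 (P j * P j'))) (n := 4 * L) ?_ hp
    · simpa only [LinearMap.comp_apply, LinearMap.mulLeft_apply] using this
    · intro m hm
      have h1 : (4 * L * (j + j') + m) / (4 * L) = j + j' := by
        rw [Nat.mul_add_div (by omega), Nat.div_eq_of_lt hm, add_zero]
      have h2 : (4 * L * (j + j') + m) % (4 * L) = m := by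
        rw [Nat.mul_add_mod, Nat.mod_eq_of_lt hm]
      simp only [LinearMap.comp_apply, LinearMap.mulLeft_apply]
      rw [← pow_add, hφ', h1, h2, hQ j hj j' hj', mul_comm]
  · intro m
    rw [hφ']
    by_cases hs : m / (4 * L) ∈ D
    · simpa using hK _ hs φ Φ hΦ' (m % (4 * L))
    · rw [hQ0 _ hs]
      simp only [mul_zero, map_zero, norm_zero]
      positivity
  · nlinarith [Nat.zero_le (∑ s ∈ D, s + ∑ j ∈ J, j)]
  · intro j hj
    have := single_le_sum (f := fun j : ℕ => j) (fun _ _ => Nat.zero_le _) hj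
    nlinarith [Nat.zero_le (∑ s ∈ D, s), Nat.mul_le_mul_left (4 * L) this]
  · intro m hm
    have h1 := (Nat.le_div_iff_mul_le (by omega)).2 ((mul_comm _ _).trans_le hm)
    rw [hφ', hQ0, mul_zero, map_zero]
    intro hs
    have := single_le_sum (f := fun j : ℕ => j) (fun _ _ => Nat.zero_le _) hs
    omega

namespace IsBlockExtension

variable {q q' : ℕ → 𝕜[X]} {φ φ' : 𝕜[X] →ₗ[𝕜] 𝕜} {J : Finset ℕ} {P : ℕ → 𝕜[X]} {A L N : ℕ}

theorem eq_of_lt (h : IsBlockExtension q q' φ φ' J P A L) (hJ : 0 ∉ J) {i : ℕ}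
    (hi : i < 4 * L) : q' i = q i := by
  simpa using h.gap 0 i hi (by simp [hJ])

theorem cases (h : IsBlockExtension q q' φ φ' J P A L) (hL : 0 < L) (i : ℕ) :
    (∃ j ∈ J, ∃ r < L, i = 4 * L * j + r) ∨
      ((∀ j ∈ J, ∀ r < L, i ≠ 4 * L * j + r) ∧ q' i = q i) := by
  have e := Nat.div_add_mod i (4 * L)
  have hr := Nat.mod_lt i (show 0 < 4 * L by omega)
  by_cases hi : i / (4 * L) ∈ J ∧ i % (4 * L) < L
  · exact .inl ⟨_, hi.1, _, hi.2, e.symm⟩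
  · refine .inr ⟨?_, ?_⟩
    · rintro j hj r hrL rfl
      rw [Nat.mul_add_div (by omega), Nat.div_eq_of_lt (by omega), add_zero, Nat.mul_add_mod,
        Nat.mod_eq_of_lt (by omega)] at hi
      exact hi ⟨hj, hrL⟩
    · have := h.gap _ _ hr hi
      rwa [e] at this

theorem degree_eq (h : IsBlockExtension q q' φ φ' J P A L) (hJ : 0 ∉ J) (hL : 0 < L)
    (hA : 0 < A) (hq : ∀ i, (q i).degree = i) (hP : ∀ j ∈ J, (P j).natDegree < L) (i : ℕ) :
    (q' i).degree = i := by
  rcases h.cases hL i with ⟨j, hj, r, hr, rfl⟩ | ⟨-, hi⟩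
  · have hj0 : 1 ≤ j := Nat.pos_of_ne_zero fun h0 => hJ (h0 ▸ hj)
    have hA0 : (A : 𝕜) / 2 ^ r ≠ 0 := by
      have : (A : 𝕜) ≠ 0 := by exact_mod_cast hA.ne'
      exact div_ne_zero this (pow_ne_zero _ two_ne_zero)
    have hlt : (P j).degree < (X ^ (4 * L * j) : 𝕜[X]).degree := by
      rw [degree_X_pow]
      refine (degree_le_natDegree).trans_lt ?_
      have := hP j hj
      have : L ≤ 4 * L * j := by nlinarith
      exact_mod_cast (by omega : (P j).natDegree < 4 * L * j)
    rw [h.block j hj r hr, degree_C_mul hA0, degree_mul, degree_X_pow,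
      degree_sub_eq_left_of_degree_lt hlt, degree_X_pow, add_comm]
    push_cast
    rfl
  · rw [hi, hq]

/-- Against low degrees `φ'` does not distinguish `X^(4Lj)` from `P j`. Multiplying by `P j` costs
degree less than `L`, hence `3 * L` instead of `4 * L`. -/
theorem φ_block_mul (h : IsBlockExtension q q' φ φ' J P A L) (hP0 : P 0 = 1)
    (hP : ∀ j ∈ J, (P j).natDegree < L)
    {j : ℕ} (hj : j ∈ J) {p : 𝕜[X]} (hp : p.natDegree < 3 * L) :
    φ' ((X ^ (4 * L * j) - P j) * p) = 0 := by
  have h1 := h.φ_eq j (mem_insert_of_mem hj) 0 (mem_insert_self 0 J) p (by omega)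
  have h2 := h.φ_eq 0 (mem_insert_self 0 J) 0 (mem_insert_self 0 J) (P j * p)
    (natDegree_mul_le.trans_lt (by have := hP j hj; omega))
  simp only [hP0, mul_one, one_mul, add_zero, mul_zero, pow_zero] at h1 h2
  rw [sub_mul, map_sub, h1, h2, sub_self]

theorem φ_block_mul_block (h : IsBlockExtension q q' φ φ' J P A L) (hP0 : P 0 = 1)
    (hP : ∀ j ∈ J, (P j).natDegree < L)
    {j j' : ℕ} (hj : j ∈ J) (hj' : j' ∈ J) {p : 𝕜[X]} (hp : p.natDegree < 2 * L) :
    φ' ((X ^ (4 * L * j) - P j) * ((X ^ (4 * L * j') - P j') * p)) = 0 := by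
  have h1 := h.φ_eq j (mem_insert_of_mem hj) j' (mem_insert_of_mem hj') p (by omega)
  have h2 := h.φ_block_mul hP0 hP hj (p := P j' * p)
    (natDegree_mul_le.trans_lt (by have := hP j' hj'; omega))
  have h3 := h.φ_eq j' (mem_insert_of_mem hj') 0 (mem_insert_self 0 J) (P j * p)
    (natDegree_mul_le.trans_lt (by have := hP j hj; omega))
  simp only [hP0, mul_one, add_zero] at h3
  have e : (X ^ (4 * L * j) - P j) * ((X ^ (4 * L * j') - P j') * p) =
      X ^ (4 * L * (j + j')) * p - X ^ (4 * L * j') * (P j * p) -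
        (X ^ (4 * L * j) - P j) * (P j' * p) := by
    rw [mul_add, pow_add]; ring
  rw [e, map_sub, map_sub, h1, h2, h3, sub_zero, sub_eq_zero]
  congr 1
  ring

/-- The bound does not involve `L`: in a block, the division by `2^r` only helps. -/
theorem φ_q_mul (h : IsBlockExtension q q' φ φ' J P A L) {K : ℕ}
    (hL : 0 < L) {G : ℝ} (hG : ∀ m, ‖φ' (X ^ m)‖ ≤ G)
    (hKq : ∀ (i : ℕ) (ψ : 𝕜[X] →ₗ[𝕜] 𝕜) (Φ : ℝ),
      (∀ m, ‖ψ (X ^ m)‖ ≤ Φ) → ∀ t, ‖ψ (X ^ t * q i)‖ ≤ K * Φ)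
    (hKP : ∀ j ∈ J, ∀ (ψ : 𝕜[X] →ₗ[𝕜] 𝕜) (Φ : ℝ),
      (∀ m, ‖ψ (X ^ m)‖ ≤ Φ) → ∀ t, ‖ψ (X ^ t * P j)‖ ≤ K * Φ) (i t : ℕ) :
    ‖φ' (X ^ t * q' i)‖ ≤ (A + 1) * (K + 1) * G := by
  have hG0 : 0 ≤ G := (norm_nonneg _).trans (hG 0)
  rcases h.cases hL i with ⟨j, hj, r, hr, rfl⟩ | ⟨-, hi⟩
  · have e : X ^ t * q' (4 * L * j + r) =
        ((A : 𝕜) / 2 ^ r) • (X ^ (t + r + 4 * L * j) - X ^ (t + r) * P j) := by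
      rw [h.block j hj r hr, smul_eq_C_mul, pow_add, pow_add]; ring
    rw [e, map_smul, norm_smul, map_sub]
    have h1 : ‖(A : 𝕜) / 2 ^ r‖ ≤ A := by
      rw [norm_div, norm_pow, RCLike.norm_natCast, RCLike.norm_ofNat]
      exact div_le_self (Nat.cast_nonneg A) (one_le_pow₀ one_le_two)
    have h2 := norm_sub_le (φ' (X ^ (t + r + 4 * L * j))) (φ' (X ^ (t + r) * P j))
    have h3 := hKP j hj φ' G hG (t + r)
    calc _ ≤ (A : ℝ) * (G + K * G) := by
          gcongr
          exact h2.trans (add_le_add (hG _) h3)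
      _ ≤ _ := by
          have : (A : ℝ) * (G + K * G) = A * (K + 1) * G := by ring
          rw [this]
          gcongr
          linarith
  · rw [hi]
    refine (hKq i φ' G hG t).trans ?_
    gcongr
    have : (0 : ℝ) ≤ A * (K + 1) := by positivity
    linarith

/-- Products of a block element with a block element or with an index below `2 * L` are annihilated
by `φ'`. Two indices below `2 * L` give the old value of `φ`. In every other case an unmodified `q
i` with `i ≥ 2 * L` occurs, and its factor `1 / (i + 1)` absorbs `K`. -/
theorem norm_le (h : IsBlockExtension q q' φ φ' J P A L) {K : ℕ} (hJ : 0 ∉ J)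
    (hL : 0 < L) (hP0 : P 0 = 1) (hP : ∀ j ∈ J, (P j).natDegree < L)
    (hq : ∀ i, (q i).degree = i) (hN : N ≤ L)
    (hq' : ∀ i, N ≤ i → q i = C (((i : 𝕜) + 1)⁻¹) * X ^ i)
    (hφ : ∀ i j, ‖φ (q i * q j)‖ ≤ 1)
    (hK : ∀ i t, ‖φ' (X ^ t * q' i)‖ ≤ K) (hKL : K ≤ 2 * L) (i i' : ℕ) :
    ‖φ' (q' i * q' i')‖ ≤ 1 := by
  have hdeg : ∀ i, (q i).natDegree = i := fun i => natDegree_eq_of_degree_eq_some (hq i)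
  have key : ∀ i i', 2 * L ≤ i → q' i = q i →
      ‖φ' (q' i * q' i')‖ ≤ 1 := by
    intro i i' hi hqi
    have e : q' i * q' i' = ((i : 𝕜) + 1)⁻¹ • (X ^ i * q' i') := by
      rw [hqi, hq' i (by omega), smul_eq_C_mul, mul_assoc]
    rw [e, map_smul, norm_smul, norm_inv_natCast_succ, inv_mul_le_iff₀ (by positivity), mul_one]
    refine (hK i' i).trans ?_
    have : K ≤ i := by omega
    have : (K : ℝ) ≤ i := by exact_mod_cast this
    linarith
  have key' : ∀ j ∈ J, ∀ r < L, ∀ i' < 2 * L, φ' (q' (4 * L * j + r) * q' i') = 0 := by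
    intro j hj r hr i' hi'
    have e : q' (4 * L * j + r) * q' i' =
        ((A : 𝕜) / 2 ^ r) • ((X ^ (4 * L * j) - P j) * (X ^ r * q i')) := by
      rw [h.block j hj r hr, h.eq_of_lt hJ (by omega), smul_eq_C_mul]; ring
    rw [e, map_smul, h.φ_block_mul hP0 hP hj, smul_zero]
    refine natDegree_mul_le.trans_lt ?_
    rw [natDegree_X_pow, hdeg]
    omega
  rcases h.cases hL i with ⟨j, hj, r, hr, rfl⟩ | ⟨-, hqi⟩
  · rcases h.cases hL i' with ⟨j', hj', r', hr', rfl⟩ | ⟨-, hqi'⟩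
    · have e : q' (4 * L * j + r) * q' (4 * L * j' + r') =
          (((A : 𝕜) / 2 ^ r) * ((A : 𝕜) / 2 ^ r')) • ((X ^ (4 * L * j) - P j) *
            ((X ^ (4 * L * j') - P j') * X ^ (r + r'))) := by
        rw [h.block j hj r hr, h.block j' hj' r' hr', smul_eq_C_mul, map_mul, pow_add]; ring
      rw [e, map_smul, h.φ_block_mul_block hP0 hP hj hj' (by rw [natDegree_X_pow]; omega)]
      simp
    · rcases lt_or_ge i' (2 * L) with hlt | hge
      · rw [key' j hj r hr i' hlt]; simp
      · rw [mul_comm]; exact key i' _ hge hqi'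
  · rcases lt_or_ge i (2 * L) with hlt | hge
    · rcases h.cases hL i' with ⟨j', hj', r', hr', rfl⟩ | ⟨-, hqi'⟩
      · rw [mul_comm, key' j' hj' r' hr' i hlt]; simp
      · rcases lt_or_ge i' (2 * L) with hlt' | hge'
        · rw [hqi, hqi']
          have := h.φ_eq 0 (mem_insert_self 0 J) 0 (mem_insert_self 0 J) (q i * q i')
            (natDegree_mul_le.trans_lt (by rw [hdeg, hdeg]; omega))
          simp only [hP0, mul_one, one_mul, add_zero, mul_zero, pow_zero] at this
          rw [this]
          exact hφ i i'
        · rw [mul_comm]; exact key i' _ hge' hqi'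
    · exact key i _ hge hqi

end IsBlockExtension

end BlockExtensions

/-! ### Boundedness of multiplication by `X`, and the inductive construction. -/

section BoundedBases

open Polynomial Finset

variable {𝕜 : Type*} [RCLike 𝕜]

/-- Entering a block, `X^(4Lj)` equals `q' / A + P j`, and the factor `1 / (i + 1)` of the preceding
monomial outweighs the cost `D + 1`. Inside a block, multiplication by `X` doubles and shifts the
index. At its end the coefficient has decayed to `A / 2^(L-1)`, which pays for expanding into scaled
monomials, at a cost linear in `L`. -/
theorem IsBlockExtension.expands {q q' : ℕ → 𝕜[X]} {φ φ' : 𝕜[X] →ₗ[𝕜] 𝕜} {J : Finset ℕ}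
    {P : ℕ → 𝕜[X]} {A L N : ℕ} (h : IsBlockExtension q q' φ φ' J P A L) (hJ : 0 ∉ J)
    (hL : 0 < L) (hA : 0 < A) (hN : N ≤ L) (hP : ∀ j ∈ J, (P j).natDegree < L)
    (hq' : ∀ i, N ≤ i → q i = C (((i : 𝕜) + 1)⁻¹) * X ^ i)
    (hq : ∀ i, ExpandsWithin q (i + 2) 2 (X * q i)) {D B : ℕ}
    (hD : ∀ j ∈ J, ExpandsWithin q L D (P j)) (hDL : D + 1 ≤ 4 * L)
    (hB : ∀ j ∈ J, ∑ i ∈ range ((P j).natDegree + 1), ‖(P j).coeff i‖ ≤ B)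
    (hAB : ∀ j ∈ J, A * (4 * L * j + L + 1 + B * (2 * L)) ≤ 2 ^ L) (i : ℕ) :
    ExpandsWithin q' (i + 2) 2 (X * q' i) := by
  rcases lt_or_ge (i + 1) (4 * L) with hi | hi
  · rw [h.eq_of_lt hJ (by omega)]
    exact (hq i).congr fun l hl => h.eq_of_lt hJ (by omega)
  rcases h.cases hL i with ⟨j, hj, r, hr, rfl⟩ | ⟨hi1, hi2⟩
  · have hj1 : 1 ≤ j := Nat.pos_of_ne_zero fun h0 => hJ (h0 ▸ hj)
    have hLj : 4 * L ≤ 4 * L * j := Nat.le_mul_of_pos_right _ hj1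
    rcases lt_or_ge (r + 1) L with hr' | hr'
    · have e : X * q' (4 * L * j + r) = C 2 * q' (4 * L * j + r + 1) := by
        have e2 : (A : 𝕜) / 2 ^ r = 2 * ((A : 𝕜) / 2 ^ (r + 1)) := by
          field_simp
          ring
        rw [add_assoc, h.block j hj r hr, h.block j hj (r + 1) hr', e2, map_mul, pow_succ X r]
        ring
      rw [e]
      refine ((ExpandsWithin.self (by omega)).C_mul 2).mono le_rfl ?_
      simp [RCLike.norm_ofNat]
    · obtain rfl : L = r + 1 := by omega
      have e : X * q' (4 * (r + 1) * j + r) = C ((A : 𝕜) / 2 ^ r) *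
          (X ^ (4 * (r + 1) * j + (r + 1)) - X ^ (r + 1) * P j) := by
        rw [h.block j hj r hr, pow_add, pow_succ X r]
        ring
      have g1 : q' (4 * (r + 1) * j + (r + 1)) = q (4 * (r + 1) * j + (r + 1)) :=
        h.gap j (r + 1) (by omega) (by simp)
      rw [hq' _ (by omega)] at g1
      have E1 := ExpandsWithin.X_pow (m := 4 * (r + 1) * j + r + 2) (by omega) g1
      have E2 : ExpandsWithin q' (4 * (r + 1) * j + r + 2)
          ((∑ i ∈ range ((P j).natDegree + 1), ‖(P j).coeff i‖) * (2 * (r + 1)))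
          (X ^ (r + 1) * P j) := by
        refine ExpandsWithin.X_pow_mul (Nat.lt_succ_self _) fun t ht => ?_
        have htL := hP j hj
        have g2 : q' (r + 1 + t) = q (r + 1 + t) := h.eq_of_lt hJ (by omega)
        rw [hq' _ (by omega)] at g2
        refine (ExpandsWithin.X_pow (by omega) g2).mono le_rfl ?_
        exact_mod_cast (by omega : r + 1 + t + 1 ≤ 2 * (r + 1))
      rw [e]
      refine ((E1.sub E2).C_mul _).mono le_rfl ?_
      rw [norm_div, norm_pow, RCLike.norm_natCast, RCLike.norm_ofNat, div_mul_eq_mul_div,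
        div_le_iff₀ (by positivity)]
      have h3 : (A : ℝ) * (4 * (r + 1) * j + (r + 1) + 1 + B * (2 * (r + 1))) ≤ 2 ^ (r + 1) := by
        exact_mod_cast hAB j hj
      rw [← pow_succ']
      refine le_trans ?_ h3
      push_cast
      gcongr
      exact hB j hj
  · have g1 := hi2
    rw [hq' _ (by omega)] at g1
    rcases h.cases hL (i + 1) with ⟨j, hj, r, hr, hir⟩ | ⟨-, hi3⟩
    · rcases r with _ | r
      · have hA0 : (A : 𝕜) ≠ 0 := by exact_mod_cast hA.ne'
        have hj1 : 1 ≤ j := Nat.pos_of_ne_zero fun h0 => hJ (h0 ▸ hj)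
        have hLj : 4 * L ≤ 4 * L * j := Nat.le_mul_of_pos_right _ hj1
        have e : X * q' i = C (((i : 𝕜) + 1)⁻¹) * (C ((A : 𝕜)⁻¹) * q' (i + 1) + P j) := by
          rw [hir, h.block j hj 0 hL, g1, pow_zero, div_one, pow_zero, one_mul, ← mul_assoc (C _),
            ← map_mul, inv_mul_cancel₀ hA0, map_one, one_mul, sub_add_cancel,
            show 4 * L * j = i + 1 by omega, pow_succ]
          ring
        have E1 : ExpandsWithin q' (i + 2) D (P j) :=
          ((hD j hj).congr fun l hl => h.eq_of_lt hJ (by omega)).mono (by omega) le_rfl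
        rw [e]
        refine ((((ExpandsWithin.self (by omega)).C_mul _).add E1).C_mul _).mono le_rfl ?_
        rw [norm_inv_natCast_succ, inv_mul_le_iff₀ (by positivity), mul_one, norm_inv,
          RCLike.norm_natCast]
        have h1 : ((A : ℝ))⁻¹ ≤ 1 := inv_le_one_of_one_le₀ (by exact_mod_cast hA)
        have h2 : (D : ℝ) + 1 ≤ i + 1 := by exact_mod_cast (by omega : D + 1 ≤ i + 1)
        linarith
      · exact absurd (by omega) (hi1 j hj r (by omega))
    · rw [hq' _ (by omega)] at hi3
      exact expandsWithin_X_mul g1 hi3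

theorem exists_mul_le_two_pow (c H : ℕ) : ∃ L, H ≤ L ∧ 0 < L ∧ c * L ≤ 2 ^ L := by
  refine ⟨2 * (c + H + 1), by omega, by omega, ?_⟩
  have h1 : c + H + 1 ≤ 2 ^ (c + H) := (Nat.lt_two_pow_self (n := c + H))
  have h2 : (2 : ℕ) ^ (2 * (c + H + 1)) = 4 * (2 ^ (c + H)) ^ 2 := by
    rw [show 2 * (c + H + 1) = 2 + (c + H) * 2 by ring, pow_add, pow_mul]; norm_num
  rw [h2]
  nlinarith [Nat.pow_le_pow_left h1 2]

/-- One step of the construction: a bounded basis can be modified far away so that `X ^ (j * n)`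
becomes close to `P j` for all `j ∈ J`. -/
theorem IsBoundedBasis.exists_extension {q : ℕ → 𝕜[X]} {φ : 𝕜[X] →ₗ[𝕜] 𝕜} {N : ℕ}
    (h : IsBoundedBasis q φ) (ht : IsTrivialFrom N q φ) {J : Finset ℕ} (hJ0 : 0 ∉ J)
    (hJ : IsSidonSet ((insert 0 J : Finset ℕ) : Set ℕ)) {P : ℕ → 𝕜[X]} (hP0 : P 0 = 1)
    {A : ℕ} (hA : 0 < A) :
    ∃ (q' : ℕ → 𝕜[X]) (φ' : 𝕜[X] →ₗ[𝕜] 𝕜) (N' n : ℕ), IsBoundedBasis q' φ' ∧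
      IsTrivialFrom N' q' φ' ∧ N < N' ∧ (∀ i < N, q' i = q i) ∧
      (∀ m < N, φ' (X ^ m) = φ (X ^ m)) ∧
      ∀ j ∈ J, j * n < N' ∧ q' (j * n) = C (A : 𝕜) * (X ^ (j * n) - P j) := by
  obtain ⟨G, hG⟩ := exists_blockExtension q φ hJ P A ht.φ_tail
  obtain ⟨d, hd⟩ := exists_nat_bound (Q := fun j d => (P j).natDegree < d)
    (fun _ _ _ => fun h1 h2 => h2.trans_le h1) J fun j _ => ⟨_, Nat.lt_succ_self _⟩
  obtain ⟨D, hD⟩ := exists_nat_bound (Q := fun j D => ExpandsWithin q d D (P j))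
    (fun _ _ _ h1 h2 => h2.mono le_rfl (by exact_mod_cast h1)) J fun j hj => by
      obtain ⟨R, hR⟩ := exists_expandsWithin h.degree_q d (P j)
        (degree_le_natDegree.trans_lt (by exact_mod_cast hd j hj))
      obtain ⟨D, hD⟩ := exists_nat_ge R
      exact ⟨D, hR.mono le_rfl hD⟩
  obtain ⟨B, hB⟩ := exists_nat_bound
    (Q := fun j B => ∑ i ∈ range ((P j).natDegree + 1), ‖(P j).coeff i‖ ≤ (B : ℝ))
    (fun _ _ _ h1 h2 => h2.trans (by exact_mod_cast h1)) J fun j _ => exists_nat_ge _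
  obtain ⟨b, hb⟩ := exists_nat_bound (Q := fun j b => j ≤ b) (fun _ _ _ h1 h2 => h2.trans h1) J
    fun j _ => ⟨j, le_rfl⟩
  obtain ⟨K₁, hK₁⟩ := exists_uniform_functional_bound q (range N)
  obtain ⟨K₂, hK₂⟩ := exists_uniform_functional_bound P J
  set K := K₁ + K₂ + 1
  have hKq : ∀ (i : ℕ) (ψ : 𝕜[X] →ₗ[𝕜] 𝕜) (Φ : ℝ),
      (∀ m, ‖ψ (X ^ m)‖ ≤ Φ) → ∀ t, ‖ψ (X ^ t * q i)‖ ≤ K * Φ := by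
    intro i ψ Φ hψ t
    have hΦ : 0 ≤ Φ := (norm_nonneg _).trans (hψ 0)
    rcases lt_or_ge i N with hi | hi
    · refine (hK₁ i (mem_range.2 hi) ψ Φ hψ t).trans ?_
      gcongr
      omega
    · rw [ht.q_tail i hi, mul_left_comm, ← smul_eq_C_mul, map_smul, norm_smul, ← pow_add,
        norm_inv_natCast_succ]
      have h1 : ((i : ℝ) + 1)⁻¹ ≤ 1 := inv_le_one_of_one_le₀ (by simp)
      have h2 : (1 : ℝ) ≤ K := by exact_mod_cast (by omega : 1 ≤ K)
      exact mul_le_mul (h1.trans h2) (hψ _) (norm_nonneg _) (by positivity)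
  have hKP : ∀ j ∈ J, ∀ (ψ : 𝕜[X] →ₗ[𝕜] 𝕜) (Φ : ℝ),
      (∀ m, ‖ψ (X ^ m)‖ ≤ Φ) → ∀ t, ‖ψ (X ^ t * P j)‖ ≤ K * Φ := by
    intro j hj ψ Φ hψ t
    have hΦ : 0 ≤ Φ := (norm_nonneg _).trans (hψ 0)
    refine (hK₂ j hj ψ Φ hψ t).trans ?_
    gcongr
    omega
  -- `2^L` has to dominate the cost of leaving a block, at most `A * (4b + 2 + 2B) * L`; the lower
  -- bound on `L` covers the supports, the entry cost `D` and the bound of `φ_q_mul`.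
  obtain ⟨L, hHL, hL, hpow⟩ := exists_mul_le_two_pow (A * (4 * b + 2 + 2 * B))
    (N + d + D + (A + 1) * (K + 1) * G)
  obtain ⟨q', φ', N', hE, hG', hN', hJN, hφ'⟩ := hG L (by omega) hL
  have hP : ∀ j ∈ J, (P j).natDegree < L := fun j hj => (hd j hj).trans_le (by omega)
  refine ⟨q', φ', N', 4 * L, ⟨?_, ?_, ?_, ?_, ?_⟩, ⟨?_, hφ'⟩, by omega, ?_, ?_, ?_⟩
  · rw [hE.eq_of_lt hJ0 (by omega), h.q_zero]
  · exact hE.degree_eq hJ0 hL hA h.degree_q hP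
  · refine hE.expands hJ0 hL hA (N := N) (by omega) hP ht.q_tail h.expands (D := D) (B := B)
      (fun j hj => (hD j hj).mono (by omega) le_rfl) (by omega) hB fun j hj => ?_
    refine le_trans ?_ hpow
    rw [mul_assoc A]
    refine Nat.mul_le_mul_left A ?_
    have := Nat.mul_le_mul_left (4 * L) (hb j hj)
    nlinarith
  · refine hE.norm_le hJ0 hL hP0 hP h.degree_q (N := N) (by omega) ht.q_tail h.norm_le
      (K := (A + 1) * (K + 1) * G) ?_ (by omega)
    intro i t
    exact_mod_cast hE.φ_q_mul hL hG' hKq hKP i t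
  · have := hE.φ_eq 0 (mem_insert_self 0 J) 0 (mem_insert_self 0 J) 1 (by simpa using hL)
    simpa [hP0, h.map_one] using this
  · intro i hi
    rcases hE.cases hL i with ⟨j, hj, r, hr, rfl⟩ | ⟨-, hqi⟩
    · have := hJN j hj
      omega
    · rw [hqi, ht.q_tail i (by omega)]
  · intro i hi
    exact hE.eq_of_lt hJ0 (by omega)
  · intro m hm
    have := hE.φ_eq 0 (mem_insert_self 0 J) 0 (mem_insert_self 0 J) (X ^ m)
      (by rw [natDegree_X_pow]; omega)
    simpa [hP0] using this
  · intro j hj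
    rw [mul_comm j]
    refine ⟨by have := hJN j hj; omega, ?_⟩
    simpa using hE.block j hj 0 hL

/-- Iterating `IsBoundedBasis.exists_extension` along a sequence of finite sets of exponents `J k`,
targets `P k` and precisions `A k`. -/
theorem exists_isBoundedBasis_approximating {S : Set ℕ} (hS0 : 0 ∉ S)
    (hS : IsSidonSet (S ∪ {0})) (J : ℕ → Finset ℕ) (hJ : ∀ k, (J k : Set ℕ) ⊆ S)
    (P : ℕ → ℕ → 𝕜[X]) (A : ℕ → ℕ) (hA : ∀ k, 0 < A k) :
    ∃ (q : ℕ → 𝕜[X]) (φ : 𝕜[X] →ₗ[𝕜] 𝕜), IsBoundedBasis q φ ∧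
      ∀ k, ∃ n, ∀ j ∈ J k, q (j * n) = C (A k : 𝕜) * (X ^ (j * n) - P k j) := by
  let State := {s : (ℕ → 𝕜[X]) × (𝕜[X] →ₗ[𝕜] 𝕜) × ℕ //
    IsBoundedBasis s.1 s.2.1 ∧ IsTrivialFrom s.2.2 s.1 s.2.1}
  have step : ∀ (k : ℕ) (s : State), ∃ t : State, s.1.2.2 < t.1.2.2 ∧
      (∀ i < s.1.2.2, t.1.1 i = s.1.1 i) ∧
      (∀ m < s.1.2.2, t.1.2.1 (X ^ m) = s.1.2.1 (X ^ m)) ∧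
      ∃ n, ∀ j ∈ J k, j * n < t.1.2.2 ∧ t.1.1 (j * n) = C (A k : 𝕜) * (X ^ (j * n) - P k j) := by
    rintro k ⟨⟨q, φ, N⟩, hb, ht⟩
    have h0 : 0 ∉ J k := fun h => hS0 (hJ k h)
    have hsub : ((insert 0 (J k) : Finset ℕ) : Set ℕ) ⊆ S ∪ {0} := by
      rw [coe_insert, Set.union_singleton]
      exact Set.insert_subset_insert (hJ k)
    obtain ⟨q', φ', N', n, h1, h2, h3, h4, h5, h6⟩ := hb.exists_extension ht h0
      (fun a ha b hb c hc d hd => hS a (hsub ha) b (hsub hb) c (hsub hc) d (hsub hd))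
      -- With `P 0 = 1`, the exponent `0` obeys the same product rule, which makes the new
      -- functional extend the old one.
      (P := Function.update (P k) 0 1) (by simp) (hA k)
    refine ⟨⟨(q', φ', N'), h1, h2⟩, h3, h4, h5, n, fun j hj => ?_⟩
    have hj0 : j ≠ 0 := by rintro rfl; exact h0 hj
    have := h6 j hj
    rwa [Function.update_of_ne hj0] at this
  choose next hnext using step
  obtain ⟨q₀, φ₀, hb₀, ht₀⟩ := exists_isBoundedBasis (𝕜 := 𝕜)
  let s : ℕ → State := fun k => Nat.rec ⟨(q₀, φ₀, 1), hb₀, ht₀⟩ next k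
  have hs : ∀ k, s (k + 1) = next k (s k) := fun k => rfl
  let N : ℕ → ℕ := fun k => (s k).1.2.2
  have hN : StrictMono N := strictMono_nat_of_lt_succ fun k => by
    simp only [N, hs]; exact (hnext k (s k)).1
  -- Stage `k` is final below `N k`, so the diagonal choices of `q` and `φ` agree with all
  -- sufficiently late stages.
  have hNk : ∀ k, k < N k := by
    intro k
    induction k with
    | zero => exact Nat.one_pos
    | succ k ih => exact lt_of_le_of_lt ih (hN k.lt_succ_self)
  have stable : ∀ k l, k ≤ l → (∀ i < N k, (s l).1.1 i = (s k).1.1 i) ∧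
      ∀ m < N k, (s l).1.2.1 (X ^ m) = (s k).1.2.1 (X ^ m) := by
    intro k l hkl
    induction l, hkl using Nat.le_induction with
    | base => exact ⟨fun _ _ => rfl, fun _ _ => rfl⟩
    | succ l hkl ih =>
      obtain ⟨-, h1, h2, -⟩ := hnext l (s l)
      have hkl' : N k ≤ N l := hN.monotone hkl
      exact ⟨fun i hi => (h1 i (hi.trans_le hkl')).trans (ih.1 i hi),
        fun m hm => (h2 m (hm.trans_le hkl')).trans (ih.2 m hm)⟩
  obtain ⟨φ, hφ⟩ := exists_linearMap_X_pow (fun m => (s m).1.2.1 (X ^ m))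
  let q : ℕ → 𝕜[X] := fun i => (s i).1.1 i
  have hq : ∀ k, ∀ i < N k, q i = (s k).1.1 i := by
    intro k i hi
    rcases le_total i k with h | h
    · exact ((stable i k h).1 i (hNk i)).symm
    · exact (stable k i h).1 i hi
  have hφ' : ∀ k, ∀ p : 𝕜[X], p.natDegree < N k → φ p = (s k).1.2.1 p := by
    intro k p hp
    refine linearMap_eq_of_natDegree_lt (fun m hm => ?_) hp
    rw [hφ]
    rcases le_total m k with h | h
    · exact ((stable m k h).2 m (hNk m)).symm
    · exact (stable k m h).2 m hm
  refine ⟨q, φ, ⟨?_, ?_, ?_, ?_, ?_⟩, ?_⟩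
  · exact (s 0).2.1.q_zero
  · exact fun i => (s i).2.1.degree_q i
  · intro i
    have h1 : i + 2 < N (i + 2) := hNk (i + 2)
    rw [hq (i + 2) i (by omega)]
    exact ((s (i + 2)).2.1.expands i).congr fun l hl => hq (i + 2) l (by omega)
  · intro i j
    have h1 := hNk (i + j)
    rw [hq (i + j) i (by omega), hq (i + j) j (by omega), hφ' (i + j)]
    · exact (s (i + j)).2.1.norm_le i j
    · refine natDegree_mul_le.trans_lt ?_
      rw [natDegree_eq_of_degree_eq_some ((s (i + j)).2.1.degree_q i),
        natDegree_eq_of_degree_eq_some ((s (i + j)).2.1.degree_q j)]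
      exact h1
  · rw [hφ' 0 1 (by simpa using hNk 0)]
    exact (s 0).2.1.map_one
  · intro k
    obtain ⟨-, -, -, n, hn⟩ := hnext k (s k)
    refine ⟨n, fun j hj => ?_⟩
    rw [hq (k + 1) _ (hn j hj).1]
    exact (hn j hj).2

end BoundedBases

/-! ### Transfer to `ℓ¹` and the hypercyclic vector. -/

section SummableSequences

open Polynomial Filter Topology

variable {𝕜 : Type*} [RCLike 𝕜]

theorem lp_one_summable_norm (x : lp (fun _ : ℕ => 𝕜) 1) : Summable fun i => ‖x i‖ := by
  simpa using (lp.memℓp x).summable (by simp)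

theorem lp_one_norm_eq (x : lp (fun _ : ℕ => 𝕜) 1) : ‖x‖ = ∑' i, ‖x i‖ := by
  simpa using lp.norm_eq_tsum_rpow (p := 1) (by simp) x

theorem lp_one_exists_clm {F : Type*} [NormedAddCommGroup F] [NormedSpace 𝕜 F] [CompleteSpace F]
    (t : ℕ → F) {M : ℝ} (ht : ∀ i, ‖t i‖ ≤ M) :
    ∃ T : lp (fun _ : ℕ => 𝕜) 1 →L[𝕜] F, ∀ i, T (lp.single 1 i (1 : 𝕜)) = t i := by
  have hle : ∀ (x : lp (fun _ : ℕ => 𝕜) 1) i, ‖x i • t i‖ ≤ ‖x i‖ * M := fun x i => by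
    rw [norm_smul]; gcongr; exact ht i
  have hn : ∀ x : lp (fun _ : ℕ => 𝕜) 1, Summable fun i => ‖x i • t i‖ := fun x =>
    Summable.of_nonneg_of_le (fun _ => norm_nonneg _) (hle x) ((lp_one_summable_norm x).mul_right M)
  refine ⟨LinearMap.mkContinuous
    { toFun := fun x => ∑' i, x i • t i
      map_add' := fun x y => by
        rw [← (hn x).of_norm.tsum_add (hn y).of_norm]
        exact tsum_congr fun i => by rw [lp.coeFn_add, Pi.add_apply, add_smul]
      map_smul' := fun c x => by
        rw [RingHom.id_apply, ← (hn x).of_norm.tsum_const_smul]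
        exact tsum_congr fun i => by rw [lp.coeFn_smul, Pi.smul_apply, smul_assoc] } M ?_, ?_⟩
  · intro x
    refine (norm_tsum_le_tsum_norm (hn x)).trans ?_
    rw [lp_one_norm_eq, mul_comm, ← tsum_mul_right]
    exact (hn x).tsum_le_tsum (hle x) ((lp_one_summable_norm x).mul_right M)
  · intro i
    simp only [LinearMap.mkContinuous_apply, LinearMap.coe_mk, AddHom.coe_mk]
    rw [tsum_eq_single i fun k hk => by simp [hk]]
    simp

/-- `U` sends `q i` to the unit vector `e i`. On `ℓ¹` a uniform bound on unit vectors suffices for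
continuity, so the bounds of `IsBoundedBasis` extend multiplication by `X` and the form. -/
theorem IsBoundedBasis.exists_model {q : ℕ → 𝕜[X]} {φ : 𝕜[X] →ₗ[𝕜] 𝕜}
    (h : IsBoundedBasis q φ) :
    ∃ (U : 𝕜[X] →ₗ[𝕜] lp (fun _ : ℕ => 𝕜) 1)
      (T : lp (fun _ : ℕ => 𝕜) 1 →L[𝕜] lp (fun _ : ℕ => 𝕜) 1)
      (B : lp (fun _ : ℕ => 𝕜) 1 →L[𝕜] lp (fun _ : ℕ => 𝕜) 1 →L[𝕜] 𝕜),
      DenseRange U ∧ (∀ i, ‖U (q i)‖ = 1) ∧ (∀ p, T (U p) = U (X * p)) ∧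
      ∀ p p', B (U p) (U p') = φ (p * p') := by
  let Q : Polynomial.Sequence 𝕜 := ⟨q, h.degree_q⟩
  have hQ : ∀ i, IsUnit (Q i).leadingCoeff := fun i =>
    (leadingCoeff_ne_zero.2 (Q.ne_zero i)).isUnit
  let b := Q.basis hQ
  have hb : ∀ i, b i = q i := Q.basis_eq_self hQ
  let e : ℕ → lp (fun _ : ℕ => 𝕜) 1 := fun i => lp.single 1 i (1 : 𝕜)
  have he : ∀ i, ‖e i‖ = 1 := fun i => by simp [e, lp.norm_single]
  let U : 𝕜[X] →ₗ[𝕜] lp (fun _ : ℕ => 𝕜) 1 := b.constr 𝕜 e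
  have hU : ∀ i, U (q i) = e i := fun i => by rw [← hb]; exact b.constr_basis 𝕜 e i
  have hT2 : ∀ i, ‖U (X * q i)‖ ≤ 2 := fun i => by
    obtain ⟨a, hp, ha⟩ := h.expands i
    rw [hp, map_sum]
    refine (norm_sum_le _ _).trans (le_trans (Finset.sum_le_sum fun l _ => ?_) ha)
    rw [← smul_eq_C_mul, map_smul, norm_smul, hU, he, mul_one]
  obtain ⟨T, hT⟩ := lp_one_exists_clm (𝕜 := 𝕜) (fun i => U (X * q i)) hT2
  have hB1 : ∀ i, ∃ β : lp (fun _ : ℕ => 𝕜) 1 →L[𝕜] 𝕜, ‖β‖ ≤ 1 ∧ ∀ j, β (e j) = φ (q i * q j) := by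
    intro i
    obtain ⟨β, hβ⟩ := lp_one_exists_clm (𝕜 := 𝕜) (fun j => φ (q i * q j)) (h.norm_le i)
    refine ⟨β, β.opNorm_le_bound zero_le_one fun x => ?_, hβ⟩
    have hs := β.hasSum (lp.hasSum_single (by simp) x)
    have hx : ∀ j, ‖β (lp.single 1 j (x j))‖ ≤ ‖x j‖ := fun j => by
      have : lp.single 1 j (x j) = x j • e j := by
        rw [← lp.single_smul, smul_eq_mul, mul_one]
      rw [this, map_smul, norm_smul, hβ]
      exact mul_le_of_le_one_right (norm_nonneg _) (h.norm_le i j)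
    rw [← hs.tsum_eq, one_mul, lp_one_norm_eq]
    exact tsum_of_norm_bounded (lp_one_summable_norm x).hasSum hx
  choose β hβ hβe using hB1
  obtain ⟨B, hB⟩ := lp_one_exists_clm (𝕜 := 𝕜) β hβ
  refine ⟨U, T, B, ?_, fun i => by rw [hU, he], ?_, ?_⟩
  · intro x
    refine mem_closure_of_tendsto (lp.hasSum_single (by simp) x) (Eventually.of_forall fun s => ?_)
    refine ⟨∑ i ∈ s, C (x i) * q i, ?_⟩
    rw [map_sum]
    refine Finset.sum_congr rfl fun i _ => ?_
    rw [← smul_eq_C_mul, map_smul, hU, ← lp.single_smul, smul_eq_mul, mul_one]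
  · intro p
    have : T.toLinearMap.comp U = U.comp (LinearMap.mulLeft 𝕜 X) := b.ext fun i => by
      simp only [hb, LinearMap.comp_apply, hU, LinearMap.mulLeft_apply]
      exact hT i
    exact LinearMap.congr_fun this p
  · intro p p'
    have : (LinearMap.compl₁₂ (ContinuousLinearMap.coeLM 𝕜 ∘ₗ B.toLinearMap) U U) =
        (LinearMap.mul 𝕜 𝕜[X]).compr₂ φ := b.ext fun i => b.ext fun j => by
      simp only [hb, LinearMap.compl₁₂_apply, hU, LinearMap.compr₂_apply, LinearMap.mul_apply',
        LinearMap.comp_apply]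
      rw [← hβe, ← hB]
      rfl
    exact LinearMap.congr_fun₂ this p p'

/-- The polynomial with the given list of coefficients, taken from a sequence of scalars. -/
noncomputable def listPolynomial (d : ℕ → 𝕜) : List ℕ → 𝕜[X]
  | [] => 0
  | a :: l => C (d a) + X * listPolynomial d l

/-- Horner's scheme: `U (a + X * p) = a • U 1 + T (U p)` is continuous in `(a, U p)`, so
coefficients can be approximated one at a time. The countable index set allows the targets to be
enumerated. -/
theorem dense_listPolynomial {E : Type*} [NormedAddCommGroup E] [NormedSpace 𝕜 E]
    {d : ℕ → 𝕜} (hd : DenseRange d) {U : 𝕜[X] →ₗ[𝕜] E} (hU : DenseRange U) (T : E →L[𝕜] E)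
    (hT : ∀ p, T (U p) = U (X * p)) : DenseRange fun l => U (listPolynomial d l) := by
  have key : ∀ n : ℕ, ∀ p : 𝕜[X], p.degree < n →
      U p ∈ closure (Set.range fun l => U (listPolynomial d l)) := by
    intro n
    induction n with
    | zero =>
      intro p hp
      have : p = 0 := degree_eq_bot.1 (Nat.WithBot.lt_zero_iff.1 (by simpa using hp))
      exact subset_closure ⟨[], by rw [this]; rfl⟩
    | succ n ih =>
      intro p hp
      have hdiv : p.divX.degree < n := by
        rw [degree_lt_iff_coeff_zero] at hp ⊢
        exact fun k hk => by rw [coeff_divX]; exact hp _ (by omega)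
      have e : ∀ (a : 𝕜) (p : 𝕜[X]), U (C a + X * p) = a • U 1 + T (U p) := fun a p => by
        rw [hT, map_add, ← map_smul, smul_eq_C_mul, mul_one]
      have hc : Continuous (Function.uncurry fun (a : 𝕜) (y : E) => a • U 1 + T y) := by
        unfold Function.uncurry
        fun_prop
      have := map_mem_closure₂ hc (hd (p.coeff 0)) (ih _ hdiv)
        (u := Set.range fun l => U (listPolynomial d l)) (by
          rintro _ ⟨a, rfl⟩ _ ⟨l, rfl⟩
          exact ⟨a :: l, e _ _⟩)
      rwa [← e, add_comm, mul_comm, divX_mul_X_add] at this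
  intro x
  exact closure_minimal (Set.range_subset_iff.2 fun p =>
    key (p.natDegree + 1) p (degree_le_natDegree.trans_lt (by exact_mod_cast Nat.lt_succ_self _))) isClosed_closure (hU x)

/-- If `S ∪ {0}` is Sidon, some operator on `ℓ¹` that is not weakly mixing has disjoint hypercyclic
powers `T ^ j`, `j ∈ J`, for all finite `J ⊆ S`, with a common vector. -/
theorem exists_operator_of_isSidonSet {S : Set ℕ} (hS0 : 0 ∉ S) (hS : IsSidonSet (S ∪ {0})) :
    ∃ T : lp (fun _ : ℕ => 𝕜) 1 →L[𝕜] lp (fun _ : ℕ => 𝕜) 1,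
      ¬ IsWeaklyMixing T ∧
        ∀ J : Finset ℕ, (J : Set ℕ) ⊆ S →
          IsDisjointHypercyclic (fun j : J => T ^ (j : ℕ)) := by
  let d : ℕ → 𝕜 := TopologicalSpace.denseSeq 𝕜
  have hd : DenseRange d := TopologicalSpace.denseRange_denseSeq 𝕜
  -- A task consists of a finite set of exponents, a code of the target polynomial for each
  -- exponent, and a precision; there are countably many tasks.
  let Data := {J : Finset ℕ // (J : Set ℕ) ⊆ S} × (ℕ →₀ ℕ) × ℕ
  have : Nonempty Data := ⟨⟨∅, by simp⟩, 0, 0⟩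
  obtain ⟨f, hf⟩ := exists_surjective_nat Data
  obtain ⟨q, φ, hq, hn⟩ := exists_isBoundedBasis_approximating hS0 hS
    (fun k => (f k).1.1) (fun k => (f k).1.2)
    (fun k j => listPolynomial d (Denumerable.ofNat (List ℕ) ((f k).2.1 j))) (fun k => (f k).2.2 + 1) fun k => Nat.succ_pos _
  obtain ⟨U, T, B, hU, hUq, hT, hB⟩ := hq.exists_model
  have hpow : ∀ n p, (T ^ n) (U p) = U (X ^ n * p) := by
    intro n
    induction n with
    | zero => simp
    | succ n ih => intro p; rw [pow_succ', mul_apply_eq_comp, ih, hT, ← mul_assoc, ← pow_succ']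
  refine ⟨T, not_isWeaklyMixing_of_bilin B ?_ ?_, fun J hJ => ⟨U 1, fun V hV hVn => ?_⟩⟩
  · intro h0
    have := hB 1 1
    rw [h0, mul_one, hq.map_one] at this
    simp at this
  · have h1 : ∀ p y, B (T (U p)) y = B (U p) (T y) := fun p y => by
      refine hU.induction_on (p := fun y => B (T (U p)) y = B (U p) (T y)) y
        (isClosed_eq (by fun_prop) (by fun_prop)) fun p' => ?_
      rw [hT, hT, hB, hB, mul_left_comm, mul_assoc]
    intro x y
    exact hU.induction_on (p := fun x => B (T x) y = B x (T y)) x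
      (isClosed_eq (by fun_prop) (by fun_prop)) fun p => h1 p y
  · have hdl := dense_listPolynomial hd hU T hT
    have h1 : ∀ j : J, ∃ l : List ℕ, ∃ m : ℕ,
        ∀ x, ‖x - U (listPolynomial d l)‖ ≤ 1 / ((m : ℝ) + 1) → x ∈ V j := by
      intro j
      obtain ⟨l, hl⟩ := hdl.exists_mem_open (hV j) (hVn j)
      obtain ⟨ε, hε, hball⟩ := Metric.isOpen_iff.1 (hV j) _ hl
      obtain ⟨m, hm⟩ := exists_nat_one_div_lt hε
      exact ⟨l, m, fun x hx => hball (by rw [Metric.mem_ball, dist_eq_norm]; linarith)⟩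
    choose l m hlm using h1
    obtain ⟨k, hk⟩ := hf (⟨J, hJ⟩, Finsupp.onFinset J (fun j => if h : j ∈ J then Encodable.encode (l ⟨j, h⟩) else 0)
      (fun j hj => by by_contra h; exact hj (dif_neg h)), ∑ j, m j)
    obtain ⟨n, hn⟩ := hn k
    rw [hk] at hn
    refine ⟨n, fun j => hlm j _ ?_⟩
    have h2 := hn j j.2
    simp only [Finsupp.onFinset_apply, j.2, dif_pos, Denumerable.ofNat_encode] at h2
    -- That `q (j * n)` has norm `1` says precisely that `T^(jn) (U 1)` is at distance `1 / A` from
    -- its target, where `A = ∑ m j + 1` serves all `j` at once.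
    have h3 := hUq (j * n)
    rw [h2, ← smul_eq_C_mul, map_smul, norm_smul, RCLike.norm_natCast] at h3
    rw [← pow_mul, hpow, mul_one, ← map_sub]
    have h4 : m j ≤ ∑ j, m j := Finset.single_le_sum (fun _ _ => Nat.zero_le _) (Finset.mem_univ j)
    have h5 : (m j : ℝ) + 1 ≤ ((∑ j, m j + 1 : ℕ) : ℝ) := by exact_mod_cast Nat.succ_le_succ h4
    rw [le_div_iff₀ (by positivity), mul_comm]
    exact (mul_le_mul_of_nonneg_right h5 (norm_nonneg _)).trans h3.le

end SummableSequences

theorem theorem3p5 {𝕜 : Type*} [RCLike 𝕜] (S : Set ℕ) (hS : 0 ∉ S) :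
    IsSidonSet (S ∪ {0}) ↔
      ∃ T : lp (fun _ : ℕ => 𝕜) 1 →L[𝕜] lp (fun _ : ℕ => 𝕜) 1,
        ¬ IsWeaklyMixing T ∧
          ∀ J : Finset ℕ, (J : Set ℕ) ⊆ S →
            IsDisjointHypercyclic (fun j : J => T ^ (j : ℕ)) := by
  refine ⟨exists_operator_of_isSidonSet hS, ?_⟩
  rintro ⟨T, hT, h⟩
  have : Nontrivial (lp (fun _ : ℕ => 𝕜) 1) :=
    ⟨lp.single 1 0 (1 : 𝕜), 0, fun h0 => by
      have := congrArg (fun x : lp (fun _ : ℕ => 𝕜) 1 => x 0) h0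
      simp at this⟩
  exact isSidonSet_of_disjointHypercyclic hT h
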